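/- Let $\mathbb T=\mathbb R/2\pi\mathbb Z$, $\kappa>0$, $\varepsilon\ge 0$ and $T>0$. For $f,g\in C^2(\mathbb T)$ let $\Omega_f=\{(x,y): x\in\mathbb T,\ y<f(x)\}$, let $\phi$ be the harmonic extension of $g$ to $\Omega_f$, that is, the solution of $\Delta_{x,y}\phi=0$ in $\Omega_f$, $\phi(x,f(x))=g(x)$, $\nabla_{x,y}\phi\in L^2(\Omega_f)$, and define the Dirichlet--Neumann operator by $$(G(f)g)(x)=\lim_{h\to0^-}\frac1h\big[\phi\big((x,f(x))+hN(x)\big)-\phi(x,f(x))\big],\qquad N(x)=(-\partial_xf(x),1).$$ By a solution we mean $f\in C([0,T];C^2(\mathbb T))$, differentiable in $t$ on $(0,T)$, which satisfies pointwise on $\mathbb T\times(0,T)$ $$\partial_tf=-\kappa\,G(f)f+\varepsilon\,\partial_x^2f .$$ (i) (Comparison principle) If $f_1,f_2$ are solutions and $f_1(x,0)\le f_2(x,0)$ for all $x\in\mathbb T$, then $f_1(x,t)\le f_2(x,t)$ for all $(x,t)\in\mathbb T\times[0,T]$. (ii) (Moduli of continuity) Let $f$ be a solution and $\gamma:[0,\infty)\to[0,\infty)$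 any function. If $|f(x,0)-f(y,0)|\le\gamma(|x-y|)$ for all $x,y$, then $|f(x,t)-f(y,t)|\le\gamma(|x-y|)$ for all $x,y$ and all $t\in[0,T]$. This holds both when $|x-y|$ is the distance on $\mathbb R$ (with $f$ extended $2\pi$-periodically) and when it is the distance on $\mathbb T$. (iii) (Slope) If $f$ is a solution, then for all $t\in[0,T]$ one has $\|f(\cdot,t)\|_{\mathrm{Lip}}\le\|f(\cdot,0)\|_{\mathrm{Lip}}$, where $\|g\|_{\mathrm{Lip}}=\sup_{x\ne y}|g(x)-g(y)|/|x-y|$. (iv) ($L^\infty$ contraction) If $f_1,f_2$ are solutions, then $\|f_1(\cdot,t)-f_2(\cdot,t)\|_{L^\infty(\mathbb T)}\le\|f_1(\cdot,0)-f_2(\cdot,0)\|_{L^\infty(\mathbb T)}$ for all $t\in[0,T]$. -/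

import Mathlib

open Filter Topology MeasureTheory Set
open scoped NNReal ENNReal

/-! Functions on the torus `𝕋 = ℝ / 2πℤ` are represented by `2π`-periodic functions on `ℝ`, and the
plane `ℝ²` by `ℂ`, the point `(x, y)` being `x + i y`. -/

/-- The fluid domain `{(x, y) : y < f x}` below the graph of `f`. -/
def fluidDomain (f : ℝ → ℝ) : Set ℂ := {z | z.im < f z.re}

/-- The fluid domain together with its boundary, the graph of `f`. -/
def closedFluidDomain (f : ℝ → ℝ) : Set ℂ := {z | z.im ≤ f z.re}

/-- `φ` is the harmonic extension to the fluid domain below `f` of the boundary data `g`: it is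
`2π`-periodic in the horizontal variable, harmonic in the domain, continuous up to the graph of `f`,
where it is equal to `g`, and its gradient is square integrable over one horizontal period. -/
structure IsHarmonicExtension (f g : ℝ → ℝ) (φ : ℂ → ℝ) : Prop where
  periodic : ∀ z ∈ closedFluidDomain f, φ (z + ((2 * Real.pi : ℝ) : ℂ)) = φ z
  harmonic : InnerProductSpace.HarmonicOnNhd φ (fluidDomain f)
  continuousOn : ContinuousOn φ (closedFluidDomain f)
  boundary : ∀ x : ℝ, φ ⟨x, f x⟩ = g x
  gradient_memLp : MemLp (gradient φ) 2
    (volume.restrict (fluidDomain f ∩ {z : ℂ | z.re ∈ Ioc 0 (2 * Real.pi)}))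

/-- The (non-normalized) outward normal `N(x) = (-f'(x), 1)` to the graph of `f`. -/
noncomputable def graphNormal (f : ℝ → ℝ) (x : ℝ) : ℂ := ⟨-deriv f x, 1⟩

/-- The Dirichlet-Neumann operator: `HasDirichletNeumann f g x v` says that `(G(f)g)(x)` is defined
and equal to `v`, that is, `v = lim_{h → 0⁻} (φ((x, f x) + h N(x)) - φ(x, f x)) / h` for the harmonic
extension `φ` of `g`. -/
def HasDirichletNeumann (f g : ℝ → ℝ) (x v : ℝ) : Prop :=
  ∃ φ : ℂ → ℝ, IsHarmonicExtension f g φ ∧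
    Tendsto (fun h : ℝ => (φ (⟨x, f x⟩ + (h : ℂ) * graphNormal f x) - φ ⟨x, f x⟩) / h)
      (𝓝[<] 0) (𝓝 v)

/-- `f` (with `f t x` the value at time `t` and position `x`) belongs to `C([0,T]; C²(𝕋))`. -/
structure IsContinuousInC2 (T : ℝ) (f : ℝ → ℝ → ℝ) : Prop where
  periodic : ∀ t ∈ Icc 0 T, Function.Periodic (f t) (2 * Real.pi)
  contDiff : ∀ t ∈ Icc 0 T, ContDiff ℝ 2 (f t)
  continuous : ∀ t₀ ∈ Icc 0 T, ∀ k : ℕ, k ≤ 2 →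
    TendstoUniformly (fun t x => iteratedDeriv k (f t) x) (iteratedDeriv k (f t₀)) (𝓝[Icc 0 T] t₀)

/-- `f` is a classical solution in `C([0,T]; C²(𝕋))` of `∂ₜ f = -κ G(f)f + ε ∂ₓ² f`. -/
structure IsMuskatSolution (κ ε T : ℝ) (f : ℝ → ℝ → ℝ) : Prop where
  regular : IsContinuousInC2 T f
  equation : ∀ t ∈ Ioo 0 T, ∀ x : ℝ, ∃ v : ℝ, HasDirichletNeumann (f t) (f t) x v ∧
    HasDerivAt (fun s => f s x) (-κ * v + ε * iteratedDeriv 2 (f t) x) t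

/-- The modulus of continuity `γ`, for the distance `|x - y|` on the line. -/
def HasModulus (γ : ℝ≥0 → ℝ≥0) (g : ℝ → ℝ) : Prop :=
  ∀ x y : ℝ, |g x - g y| ≤ γ (nndist x y)

/-- The modulus of continuity `γ`, for the distance on the torus `ℝ / 2πℤ`. -/
def HasTorusModulus (γ : ℝ≥0 → ℝ≥0) (g : ℝ → ℝ) : Prop :=
  ∀ x y : ℝ, |g x - g y| ≤ γ ‖((x - y : ℝ) : AddCircle (2 * Real.pi))‖₊

/-- The Lipschitz seminorm `sup_{x ≠ y} |g x - g y| / |x - y|`, possibly infinite. -/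
noncomputable def lipSeminorm (g : ℝ → ℝ) : ℝ≥0∞ :=
  ⨆ (x : ℝ) (y : ℝ) (_ : x ≠ y), ENNReal.ofReal (|g x - g y| / |x - y|)

/-- The `L^∞(𝕋)` norm of a `2π`-periodic function. -/
noncomputable def torusLInfty (g : ℝ → ℝ) : ℝ≥0∞ :=
  eLpNorm g ∞ (volume.restrict (Ioc 0 (2 * Real.pi)))

/-- At a local maximum the second derivative is nonpositive. -/
theorem IsLocalMax.deriv_deriv_nonpos {g : ℝ → ℝ} {x : ℝ} (h : IsLocalMax g x)
    (hc : ContinuousAt g x) : deriv (deriv g) x ≤ 0 := by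
  by_contra! hpos
  have hmin := isLocalMin_of_deriv_deriv_pos hpos h.deriv_eq_zero hc
  have heq : g =ᶠ[𝓝 x] fun _ => g x := by
    filter_upwards [h, hmin] with y h1 h2 using le_antisymm h1 h2
  have := heq.deriv.deriv_eq
  simp at this
  linarith

theorem mem_fluidDomain {f : ℝ → ℝ} {z : ℂ} : z ∈ fluidDomain f ↔ z.im < f z.re := Iff.rfl

theorem mem_closedFluidDomain {f : ℝ → ℝ} {z : ℂ} :
    z ∈ closedFluidDomain f ↔ z.im ≤ f z.re := Iff.rfl

theorem fluidDomain_subset (f : ℝ → ℝ) : fluidDomain f ⊆ closedFluidDomain f :=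
  fun _ hz => mem_closedFluidDomain.2 (mem_fluidDomain.1 hz).le

theorem isOpen_fluidDomain {f : ℝ → ℝ} (hf : Continuous f) : IsOpen (fluidDomain f) :=
  isOpen_lt Complex.continuous_im (hf.comp Complex.continuous_re)

theorem isClosed_closedFluidDomain {f : ℝ → ℝ} (hf : Continuous f) :
    IsClosed (closedFluidDomain f) :=
  isClosed_le Complex.continuous_im (hf.comp Complex.continuous_re)

theorem Function.Periodic.exists_le_forall {f : ℝ → ℝ} {c : ℝ} (hfp : Function.Periodic f c)
    (hc : c ≠ 0) (hf : Continuous f) : ∃ m, ∀ x, m ≤ f x := by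
  obtain ⟨m, hm⟩ := (hfp.compact_of_continuous hc hf).bddBelow
  exact ⟨m, fun x => hm (mem_range_self x)⟩

theorem enorm_le_lintegral_circle {F : ℂ → ℂ} {z : ℂ} {r R : ℝ} (hr : 0 < r) (hrR : r < R)
    (hF : DifferentiableOn ℂ F (Metric.ball z R)) :
    ENNReal.ofReal (2 * Real.pi) * ‖F z‖ₑ ≤
      ∫⁻ θ in Ioo (-Real.pi) Real.pi, ‖F (z + Complex.polarCoord.symm (r, θ))‖ₑ := by
  have hd : DiffContOnCl ℂ F (Metric.ball z |r|) := by
    rw [abs_of_pos hr]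
    exact (hF.mono (Metric.closedBall_subset_ball hrR)).diffContOnCl_ball subset_rfl
  have h1 := hd.circleAverage
  rw [Real.circleAverage, inv_smul_eq_iff₀ (by positivity)] at h1
  have hper : Function.Periodic (fun θ => F (circleMap z r θ)) (2 * Real.pi) := fun θ => by
    simp only [periodic_circleMap z r θ]
  have h2 := hper.intervalIntegral_add_eq (-Real.pi) 0
  rw [zero_add, h1, show -Real.pi + 2 * Real.pi = Real.pi by ring,
    intervalIntegral.integral_of_le (by linarith [Real.pi_pos]),
    integral_Ioc_eq_integral_Ioo] at h2
  have h3 : ENNReal.ofReal (2 * Real.pi) * ‖F z‖ₑ = ‖(2 * Real.pi) • F z‖ₑ := by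
    rw [enorm_smul, Real.enorm_of_nonneg (by positivity)]
  rw [h3, ← h2]
  refine (enorm_integral_le_lintegral_enorm _).trans (le_of_eq ?_)
  refine lintegral_congr fun θ => ?_
  rw [Complex.polarCoord_symm_apply, circleMap, Complex.exp_mul_I]
  push_cast
  rfl

/-- The mean value inequality for a holomorphic function on a disc. -/
theorem enorm_le_lintegral_ball {F : ℂ → ℂ} {z : ℂ}
    (hF : DifferentiableOn ℂ F (Metric.ball z 1)) :
    ENNReal.ofReal Real.pi * ‖F z‖ₑ ≤ ∫⁻ w in Metric.ball z 1, ‖F w‖ₑ := by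
  have e1 : ∫⁻ w in Metric.ball z 1, ‖F w‖ₑ =
      ∫⁻ w, (Metric.ball z 1).indicator (fun w => ‖F w‖ₑ) (z + w) := by
    rw [lintegral_add_left_eq_self, lintegral_indicator Metric.isOpen_ball.measurableSet]
  rw [e1, ← Complex.lintegral_comp_polarCoord_symm, polarCoord_target]
  have hm : Measurable ((Metric.ball z 1).indicator fun w => ‖F w‖ₑ) := by
    classical
    rw [← piecewise_eq_indicator]
    exact hF.continuousOn.enorm.measurable_piecewise continuousOn_const
      Metric.isOpen_ball.measurableSet
  have hmp : Measurable fun p : ℝ × ℝ => Complex.polarCoord.symm p := by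
    simp only [Complex.polarCoord_symm_apply]
    fun_prop
  have hm2 : Measurable fun p : ℝ × ℝ =>
      (Metric.ball z 1).indicator (fun w => ‖F w‖ₑ) (z + Complex.polarCoord.symm p) :=
    hm.comp (hmp.const_add z)
  simp only [smul_eq_mul]
  rw [Measure.volume_eq_prod, ← Measure.prod_restrict, lintegral_prod _ (by fun_prop)]
  calc ENNReal.ofReal Real.pi * ‖F z‖ₑ
      = ∫⁻ r in Ioo (0:ℝ) 1, ENNReal.ofReal r * (ENNReal.ofReal (2 * Real.pi) * ‖F z‖ₑ) := by
        have h1 : ∫⁻ r in Ioo (0:ℝ) 1, ENNReal.ofReal r = ENNReal.ofReal (1 / 2) := by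
          rw [← ofReal_integral_eq_lintegral_ofReal, ← integral_Ioc_eq_integral_Ioo,
            ← intervalIntegral.integral_of_le zero_le_one, integral_id]
          · norm_num
          · exact (continuous_id.integrableOn_Icc).mono_set Ioo_subset_Icc_self
          · exact (ae_restrict_mem measurableSet_Ioo).mono fun r hr => hr.1.le
        rw [lintegral_mul_const _ ENNReal.measurable_ofReal, h1, ← mul_assoc,
          ← ENNReal.ofReal_mul (by norm_num)]
        ring_nf
    _ ≤ ∫⁻ r in Ioo (0:ℝ) 1, ∫⁻ θ in Ioo (-Real.pi) Real.pi, ENNReal.ofReal r *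
          (Metric.ball z 1).indicator (fun w => ‖F w‖ₑ)
            (z + Complex.polarCoord.symm (r, θ)) := by
        refine setLIntegral_mono' measurableSet_Ioo fun r hr => ?_
        rw [lintegral_const_mul' _ _ ENNReal.ofReal_ne_top]
        gcongr
        refine (enorm_le_lintegral_circle hr.1 hr.2 hF).trans (le_of_eq ?_)
        refine lintegral_congr fun θ => ?_
        rw [indicator_of_mem]
        simp [-Complex.polarCoord_symm_apply, Complex.norm_polarCoord_symm, abs_of_pos hr.1, hr.2]
    _ ≤ _ := lintegral_mono_set Ioo_subset_Ioi_self

/-- The gradient of a harmonic extension tends to zero at infinite depth. -/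
theorem IsHarmonicExtension.exists_norm_fderiv_le {f g : ℝ → ℝ} {φ : ℂ → ℝ} (hf : Continuous f)
    (hfp : Function.Periodic f (2 * Real.pi)) (h : IsHarmonicExtension f g φ) {δ : ℝ}
    (hδ : 0 < δ) :
    ∃ R : ℝ, (∀ x, -R < f x) ∧ ∀ z : ℂ, z.re ∈ Icc 0 (2 * Real.pi) → z.im < -R →
      |fderiv ℝ φ z Complex.I| ≤ δ := by
  have hpi := Real.pi_gt_three
  have hopen := isOpen_fluidDomain hf
  set p : ℂ := ((2 * Real.pi : ℝ) : ℂ) with hp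
  have hpre : p.re = 2 * Real.pi := Complex.ofReal_re _
  have hpim : p.im = 0 := Complex.ofReal_im _
  set F : ℂ → ℂ := fun z => fderiv ℝ φ z 1 - Complex.I * fderiv ℝ φ z Complex.I with hF
  have hmem : ∀ w, w + p ∈ fluidDomain f ↔ w ∈ fluidDomain f := fun w => by
    simp only [mem_fluidDomain, Complex.add_re, Complex.add_im, hpre, hpim, add_zero,
      hfp w.re]
  have hFper : ∀ w ∈ fluidDomain f, F (w + p) = F w := by
    intro w hw
    have : fderiv ℝ φ (w + p) = fderiv ℝ φ w := by
      rw [← fderiv_comp_add_right]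
      refine Filter.EventuallyEq.fderiv_eq ?_
      filter_upwards [hopen.mem_nhds hw] with u hu
      exact h.periodic u (fluidDomain_subset f hu)
    simp only [hF, this]
  obtain ⟨m, hm⟩ := hfp.exists_le_forall (by positivity) hf
  set S : Set ℂ := {z | z.re ∈ Ioc 0 (2 * Real.pi)} with hS
  have hSm : MeasurableSet S := Complex.measurable_re measurableSet_Ioc
  set A := fluidDomain f ∩ S with hA
  have hAm : MeasurableSet A := hopen.measurableSet.inter hSm
  set G : ℂ → ℝ≥0∞ := fun z => ‖F z ^ 2‖ₑ with hG
  have hGA : ∫⁻ z in A, G z < ∞ := by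
    have h1 : ∫⁻ z in A, ‖gradient φ z‖ₑ ^ (2:ℝ) < ∞ := by
      have := h.gradient_memLp.2
      rw [eLpNorm_lt_top_iff_lintegral_rpow_enorm_lt_top (by norm_num) (by norm_num)] at this
      simpa only [ENNReal.toReal_ofNat] using this
    have h2 : ∀ z, G z ≤ 4 * ‖gradient φ z‖ₑ ^ (2:ℝ) := by
      intro z
      have h3 : ‖gradient φ z‖ = ‖fderiv ℝ φ z‖ := by
        simp [gradient]
      have h4 : ‖F z‖ ≤ 2 * ‖gradient φ z‖ := by
        have a1 := (fderiv ℝ φ z).le_opNorm 1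
        have a2 := (fderiv ℝ φ z).le_opNorm Complex.I
        simp only [norm_one, Complex.norm_I, mul_one] at a1 a2
        refine (norm_sub_le _ _).trans ?_
        rw [norm_mul, Complex.norm_I, Complex.norm_real, Complex.norm_real, h3]
        linarith
      have h5 : ‖F z‖ₑ ≤ 2 * ‖gradient φ z‖ₑ := by
        rw [← ofReal_norm, ← ofReal_norm, show (2:ℝ≥0∞) = ENNReal.ofReal 2 by simp,
          ← ENNReal.ofReal_mul (by norm_num)]
        exact ENNReal.ofReal_le_ofReal h4
      simp only [hG, enorm_pow]
      calc ‖F z‖ₑ ^ 2 ≤ (2 * ‖gradient φ z‖ₑ) ^ 2 := by gcongr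
        _ = 4 * ‖gradient φ z‖ₑ ^ (2:ℝ) := by
          rw [mul_pow, ENNReal.rpow_ofNat]; norm_num
    calc ∫⁻ z in A, G z ≤ ∫⁻ z in A, 4 * ‖gradient φ z‖ₑ ^ (2:ℝ) := lintegral_mono h2
      _ = 4 * ∫⁻ z in A, ‖gradient φ z‖ₑ ^ (2:ℝ) := lintegral_const_mul' _ _ (by simp)
      _ < ∞ := ENNReal.mul_lt_top (by simp) h1
  have hshift : ∀ a : ℂ, (∀ w ∈ fluidDomain f, F (w + a) = F w) → 
      ∫⁻ z in (· - a) ⁻¹' A, G z = ∫⁻ z in A, G z := by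
    intro a ha
    rw [← (measurePreserving_sub_right volume a).setLIntegral_comp_preimage_emb
      (measurableEmbedding_subRight a) G A]
    refine setLIntegral_congr_fun (measurable_sub_const a hAm) fun z hz => ?_
    have := ha (z - a) hz.1
    rw [sub_add_cancel] at this
    simp only [hG, this]
  have hB : ∃ B : Set ℂ, MeasurableSet B ∧ ∫⁻ z in B, G z < ∞ ∧
      ∀ z : ℂ, z ∈ fluidDomain f → z.re ∈ Icc (-1) (2 * Real.pi + 1) → z ∈ B := by
    have hFper' : ∀ w ∈ fluidDomain f, F (w + -p) = F w := fun w hw => by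
      rw [← hFper (w + -p) ((hmem _).1 (by simpa using hw)), neg_add_cancel_right]
    refine ⟨(· - p) ⁻¹' A ∪ A ∪ (· - (-p)) ⁻¹' A, ((measurable_sub_const p hAm).union hAm).union
      (measurable_sub_const (-p) hAm), ?_, fun z hz hzr => ?_⟩
    · refine (lintegral_union_le _ _ _).trans_lt (ENNReal.add_lt_top.2 ⟨?_, ?_⟩)
      · refine (lintegral_union_le _ _ _).trans_lt (ENNReal.add_lt_top.2 ⟨?_, hGA⟩)
        rwa [hshift p hFper]
      · rwa [hshift (-p) hFper']
    · rcases le_or_gt z.re 0 with h0 | h0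
      · refine Or.inr ⟨?_, ?_⟩
        · simpa using (hmem z).2 hz
        · simp only [hS, mem_ofPred_eq, Complex.sub_re, Complex.neg_re, hpre]
          exact ⟨by linarith [hzr.1], by linarith⟩
      rcases le_or_gt z.re (2 * Real.pi) with h1 | h1
      · exact Or.inl (Or.inr ⟨hz, h0, h1⟩)
      · refine Or.inl (Or.inl ⟨(hmem _).1 (by simpa using hz), ?_⟩)
        simp only [hS, mem_ofPred_eq, Complex.sub_re, hpre]
        exact ⟨by linarith, by linarith [hzr.2]⟩
  obtain ⟨B, hBm, hBfin, hB⟩ := hB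
  have htail : ∃ n : ℕ, ∫⁻ z in B ∩ {z : ℂ | z.im < -n}, G z < ENNReal.ofReal (Real.pi * δ ^ 2) := by
    have hms : ∀ n : ℕ, MeasurableSet (B ∩ {z : ℂ | z.im < -n}) := fun n =>
      hBm.inter (measurableSet_lt Complex.measurable_im measurable_const)
    have hlim := tendsto_measure_iInter_atTop (μ := volume.withDensity G)
      (s := fun n : ℕ => B ∩ {z : ℂ | z.im < -n}) (fun n => (hms n).nullMeasurableSet)
      (fun i j hij z hz => ⟨hz.1, lt_of_lt_of_le (show z.im < -(j:ℝ) from hz.2) (neg_le_neg (Nat.cast_le.2 hij))⟩)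
      ⟨0, by
        rw [withDensity_apply _ (hms 0)]
        exact ((lintegral_mono_set inter_subset_left).trans_lt hBfin).ne⟩
    have hempty : ⋂ n : ℕ, B ∩ {z : ℂ | z.im < -n} = ∅ := by
      refine eq_empty_of_forall_notMem fun z hz => ?_
      obtain ⟨n, hn⟩ := exists_nat_gt (-z.im)
      have : z.im < -n := (mem_iInter.1 hz n).2
      linarith
    rw [hempty, measure_empty] at hlim
    obtain ⟨n, hn⟩ := (hlim.eventually_lt_const
      (ENNReal.ofReal_pos.2 (show 0 < Real.pi * δ ^ 2 by positivity))).exists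
    rw [Function.comp_apply, withDensity_apply _ (hms n)] at hn
    exact ⟨n, hn⟩
  obtain ⟨n, hn⟩ := htail
  refine ⟨max (n + 1) (1 - m), fun x => ?_, fun z hz1 hz2 => ?_⟩
  · have := le_max_right ((n:ℝ) + 1) (1 - m)
    linarith [hm x]
  have hb : Metric.ball z 1 ⊆ fluidDomain f ∩ (B ∩ {z : ℂ | z.im < -n}) := by
    intro w hw
    rw [mem_ball_iff_norm] at hw
    have b1 := abs_le.1 ((Complex.abs_re_le_norm _).trans hw.le)
    have b2 := abs_le.1 ((Complex.abs_im_le_norm _).trans hw.le)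
    simp only [Complex.sub_re, Complex.sub_im] at b1 b2
    have c1 := le_max_left ((n:ℝ) + 1) (1 - m)
    have c2 := le_max_right ((n:ℝ) + 1) (1 - m)
    have hwf : w ∈ fluidDomain f := by
      rw [mem_fluidDomain]
      linarith [hm w.re]
    exact ⟨hwf, hB w hwf ⟨by linarith [hz1.1], by linarith [hz1.2]⟩, by show w.im < -n; linarith⟩
  have hFd : DifferentiableOn ℂ (fun w => F w ^ 2) (Metric.ball z 1) := fun w hw =>
    ((HarmonicAt.differentiableAt_complex_partial (h.harmonic w (hb hw).1)).pow 2).differentiableWithinAt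
  have h1 := ((enorm_le_lintegral_ball hFd).trans
    (lintegral_mono_set (hb.trans inter_subset_right))).trans hn.le
  rw [← ofReal_norm, ← ENNReal.ofReal_mul (by positivity),
    ENNReal.ofReal_le_ofReal_iff (by positivity), norm_pow] at h1
  have h2 : ‖F z‖ ≤ δ := by
    have := le_of_mul_le_mul_left h1 Real.pi_pos
    exact le_of_sq_le_sq this hδ.le
  refine le_trans ?_ h2
  have h3 := Complex.abs_im_le_norm (F z)
  simpa [hF] using h3

open InnerProductSpace in
/-- A real harmonic function on the plane is constant near a local maximum. -/
theorem HarmonicAt.eventually_eq_of_isLocalMax {u : ℂ → ℝ} {z : ℂ}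
    (hu : HarmonicAt u z) (hmax : IsLocalMax u z) : ∀ᶠ w in 𝓝 z, u w = u z := by
  obtain ⟨r, hr, hball⟩ := Metric.eventually_nhds_iff_ball.1 hu.eventually
  obtain ⟨F, hF, hFu⟩ := HarmonicOnNhd.exists_analyticOnNhd_ball_re_eq (f := u) (z := z) (R := r)
    fun w hw => hball w hw
  have hnorm : ∀ᶠ w in 𝓝 z, ‖Complex.exp (F w)‖ = Real.exp (u w) := by
    filter_upwards [Metric.ball_mem_nhds z hr] with w hw
    rw [Complex.norm_exp, ← hFu hw]
  have hdiff : ∀ᶠ w in 𝓝 z, DifferentiableAt ℂ (fun w => Complex.exp (F w)) w := by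
    filter_upwards [Metric.ball_mem_nhds z hr] with w hw
    exact (hF w hw).differentiableAt.cexp
  have hloc : IsLocalMax (norm ∘ fun w => Complex.exp (F w)) z := by
    filter_upwards [hmax, hnorm] with w hw hn
    simp only [Function.comp_apply]
    rw [hn, hnorm.self_of_nhds]
    exact Real.exp_le_exp.2 hw
  filter_upwards [Complex.norm_eventually_eq_of_isLocalMax hdiff hloc, hnorm] with w hw hn
  rw [hn, hnorm.self_of_nhds] at hw
  exact Real.exp_injective hw

theorem HarmonicAt.comp_add_const {u : ℂ → ℝ} {z a : ℂ}
    (hu : InnerProductSpace.HarmonicAt u (z + a)) :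
    InnerProductSpace.HarmonicAt (fun w => u (w + a)) z := by
  refine ⟨hu.1.comp z (by fun_prop), ?_⟩
  have hev := (continuous_add_const a).continuousAt.eventually hu.2
  filter_upwards [hev] with w hw
  simp only [InnerProductSpace.laplacian_eq_iteratedFDeriv_complexPlane, iteratedFDeriv_comp_add_right]
    at hw ⊢
  exact hw

theorem harmonicAt_im (z : ℂ) : InnerProductSpace.HarmonicAt Complex.im z := by
  refine ⟨Complex.imCLM.contDiff.contDiffAt, Eventually.of_forall fun w => ?_⟩
  have h : fderiv ℝ Complex.im = fun _ => Complex.imCLM := funext fun x => Complex.imCLM.fderiv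
  simp [InnerProductSpace.laplacian_eq_iteratedFDeriv_complexPlane, iteratedFDeriv_two_apply, h]

/-- Periodicity of a function on the closed fluid domain, iterated. -/
theorem exists_re_mem_Icc_of_periodic {f : ℝ → ℝ} (hfp : Function.Periodic f (2 * Real.pi))
    {u : ℂ → ℝ}
    (hu : ∀ z ∈ closedFluidDomain f, u (z + ((2 * Real.pi : ℝ) : ℂ)) = u z) {z : ℂ}
    (hz : z ∈ closedFluidDomain f) :
    ∃ w ∈ closedFluidDomain f, w.re ∈ Icc 0 (2 * Real.pi) ∧ w.im = z.im ∧ u w = u z := by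
  have hnat : ∀ n : ℕ, ∀ w ∈ closedFluidDomain f,
      w + ((n * (2 * Real.pi) : ℝ) : ℂ) ∈ closedFluidDomain f ∧
        u (w + ((n * (2 * Real.pi) : ℝ) : ℂ)) = u w := by
    intro n w hw
    have hmem : ∀ k : ℕ, w + ((k * (2 * Real.pi) : ℝ) : ℂ) ∈ closedFluidDomain f := fun k => by
      rw [mem_closedFluidDomain, Complex.add_re, Complex.add_im, Complex.ofReal_re,
        Complex.ofReal_im, add_zero, hfp.nat_mul k]
      exact hw
    refine ⟨hmem n, ?_⟩
    induction n with
    | zero => simp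
    | succ k ih =>
      rw [← ih, ← hu _ (hmem k)]
      push_cast
      ring_nf
  obtain ⟨n, hn, -⟩ := existsUnique_add_zsmul_mem_Ico Real.two_pi_pos z.re 0
  rw [zero_add, zsmul_eq_mul] at hn
  obtain ⟨k, rfl | rfl⟩ := n.eq_nat_or_neg
  · obtain ⟨h1, h2⟩ := hnat k z hz
    exact ⟨_, h1, by simpa using Ico_subset_Icc_self hn, by simp, h2⟩
  · have hmem : z - ((k * (2 * Real.pi) : ℝ) : ℂ) ∈ closedFluidDomain f := by
      rw [mem_closedFluidDomain, Complex.sub_re, Complex.sub_im, Complex.ofReal_re,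
        Complex.ofReal_im, sub_zero, hfp.sub_nat_mul_eq k]
      exact hz
    obtain ⟨h1, h2⟩ := hnat k _ hmem
    rw [sub_add_cancel] at h2
    exact ⟨_, hmem, by simpa [sub_eq_add_neg] using Ico_subset_Icc_self hn, by simp, h2.symm⟩

theorem isCompact_closedFluidDomain_inter {f : ℝ → ℝ} (hf : Continuous f) (R : ℝ) :
    IsCompact (closedFluidDomain f ∩ {z | z.re ∈ Icc 0 (2 * Real.pi) ∧ -R ≤ z.im}) := by
  obtain ⟨b, hb⟩ := (isCompact_Icc.image (f := f) (s := Icc 0 (2 * Real.pi)) hf).bddAbove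
  have hc : IsCompact (Icc (0:ℝ) (2 * Real.pi) ×ℂ Icc (-R) b) := isCompact_Icc.reProdIm isCompact_Icc
  refine hc.of_isClosed_subset ((isClosed_closedFluidDomain hf).inter
    ((isClosed_Icc.preimage Complex.continuous_re).inter
      (isClosed_le continuous_const Complex.continuous_im))) fun z hz => ?_
  exact ⟨hz.2.1, hz.2.2, (mem_closedFluidDomain.1 hz.1).trans (hb (mem_image_of_mem f hz.2.1))⟩

/-- The weak maximum principle in a periodic domain of infinite depth. -/
theorem nonpos_of_harmonicOnNhd {f : ℝ → ℝ} (hf : Continuous f)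
    (hfp : Function.Periodic f (2 * Real.pi)) {u : ℂ → ℝ}
    (hper : ∀ z ∈ closedFluidDomain f, u (z + ((2 * Real.pi : ℝ) : ℂ)) = u z)
    (harm : InnerProductSpace.HarmonicOnNhd u (fluidDomain f))
    (hcont : ContinuousOn u (closedFluidDomain f)) (hbd : ∀ x, u ⟨x, f x⟩ ≤ 0)
    (hdeep : ∃ R : ℝ, ∀ z ∈ closedFluidDomain f, z.im < -R → u z ≤ 0) {z : ℂ}
    (hz : z ∈ closedFluidDomain f) : u z ≤ 0 := by
  by_contra! hpos
  obtain ⟨R, hR⟩ := hdeep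
  set K := closedFluidDomain f ∩ {z | z.re ∈ Icc 0 (2 * Real.pi) ∧ -R ≤ z.im} with hK
  have hKc : IsCompact K := isCompact_closedFluidDomain_inter hf R
  have hred : ∀ w ∈ closedFluidDomain f, 0 < u w → ∃ w' ∈ K, u w' = u w := by
    intro w hw hw0
    obtain ⟨w', h1, h2, h3, h4⟩ := exists_re_mem_Icc_of_periodic hfp hper hw
    refine ⟨w', ⟨h1, h2, ?_⟩, h4⟩
    by_contra! hlt
    linarith [hR w' h1 hlt]
  obtain ⟨z', hz'K, hz'⟩ := hred z hz hpos
  obtain ⟨a, haK, ha⟩ := hKc.exists_isMaxOn ⟨z', hz'K⟩ (hcont.mono inter_subset_left)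
  have hapos : 0 < u a := hpos.trans_le (hz' ▸ ha hz'K)
  have hle : ∀ w ∈ closedFluidDomain f, u w ≤ u a := fun w hw => by
    rcases le_or_gt (u w) 0 with h0 | h0
    · exact h0.trans hapos.le
    · obtain ⟨w', h1, h2⟩ := hred w hw h0
      exact h2 ▸ ha h1
  have hLc : IsCompact (K ∩ u ⁻¹' {u a}) :=
    hKc.of_isClosed_subset ((hcont.mono inter_subset_left).preimage_isClosed_of_isClosed
      hKc.isClosed isClosed_singleton) inter_subset_left
  obtain ⟨b, ⟨hbK, hbu⟩, hb⟩ := hLc.exists_isMaxOn ⟨a, haK, rfl⟩ Complex.continuous_im.continuousOn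
  have hbu : u b = u a := hbu
  have hbint : b ∈ fluidDomain f := by
    refine mem_fluidDomain.2 (lt_of_le_of_ne (mem_closedFluidDomain.1 hbK.1) fun heq => ?_)
    have := hbd b.re
    rw [← heq, Complex.eta, hbu] at this
    linarith
  have hnhds := (isOpen_fluidDomain hf).mem_nhds hbint
  have hlocmax : IsLocalMax u b := by
    filter_upwards [hnhds] with w hw
    exact hbu ▸ hle w (fluidDomain_subset f hw)
  have hev := (HarmonicAt.eventually_eq_of_isLocalMax (harm b hbint) hlocmax).and hnhds
  have hcurve : Tendsto (fun s : ℝ => b + s * Complex.I) (𝓝[>] 0) (𝓝 b) := by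
    have : ContinuousAt (fun s : ℝ => b + s * Complex.I) 0 := by fun_prop
    simpa [ContinuousAt] using this.mono_left nhdsWithin_le_nhds
  obtain ⟨s, ⟨hs1, hs2⟩, hs0⟩ := ((hcurve.eventually hev).and self_mem_nhdsWithin).exists
  have hs0 : 0 < s := hs0
  have him : (b + s * Complex.I).im = b.im + s := by simp
  have hre : (b + s * Complex.I).re = b.re := by simp
  have := hb (show b + s * Complex.I ∈ K ∩ u ⁻¹' {u a} from
    ⟨⟨fluidDomain_subset f hs2, by rw [hre]; exact hbK.2.1, by rw [him]; linarith [hbK.2.2]⟩,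
      hs1.trans hbu⟩)
  have : (b + s * Complex.I).im ≤ b.im := this
  linarith

/-- `φ` is the harmonic extension of the height of the free surface, with sublinear growth. -/
structure IsSublinearExtension (f : ℝ → ℝ) (φ : ℂ → ℝ) : Prop where
  periodic : ∀ z ∈ closedFluidDomain f, φ (z + ((2 * Real.pi : ℝ) : ℂ)) = φ z
  harmonic : InnerProductSpace.HarmonicOnNhd φ (fluidDomain f)
  continuousOn : ContinuousOn φ (closedFluidDomain f)
  boundary : ∀ x : ℝ, φ ⟨x, f x⟩ = f x
  sublinear : ∀ δ > 0, ∃ C, ∀ z ∈ closedFluidDomain f, |φ z| ≤ C + δ * |z.im|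

theorem IsHarmonicExtension.isSublinearExtension {f : ℝ → ℝ} {φ : ℂ → ℝ} (hf : Continuous f)
    (hfp : Function.Periodic f (2 * Real.pi)) (h : IsHarmonicExtension f f φ) :
    IsSublinearExtension f φ := by
  refine ⟨h.periodic, h.harmonic, h.continuousOn, h.boundary, fun δ hδ => ?_⟩
  obtain ⟨R, hRf, hR⟩ := h.exists_norm_fderiv_le hf hfp hδ
  obtain ⟨C, hC⟩ := ((isCompact_closedFluidDomain_inter hf (R + 1)).image_of_continuousOn
    (h.continuousOn.mono inter_subset_left)).isBounded.exists_norm_le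
  refine ⟨C + δ * |R + 1|, fun z hz => ?_⟩
  obtain ⟨w, hw, hwr, hwi, hwz⟩ := exists_re_mem_Icc_of_periodic hfp h.periodic hz
  rw [← hwz, ← hwi]
  rcases le_or_gt (-(R + 1)) w.im with h1 | h1
  · have := hC _ (mem_image_of_mem φ ⟨hw, hwr, h1⟩)
    rw [Real.norm_eq_abs] at this
    have : 0 ≤ δ * |R + 1| := by positivity
    have : 0 ≤ δ * |w.im| := by positivity
    linarith
  · have hderiv : ∀ y ∈ Iio (-R), HasDerivWithinAt (fun y : ℝ => φ ⟨w.re, y⟩)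
        (fderiv ℝ φ ⟨w.re, y⟩ Complex.I) (Iio (-R)) y := by
      intro y hy
      have hmem : (⟨w.re, y⟩ : ℂ) ∈ fluidDomain f := mem_fluidDomain.2 ((mem_Iio.1 hy).trans (hRf _))
      have hd : DifferentiableAt ℝ φ ⟨w.re, y⟩ :=
        (h.harmonic _ hmem).1.differentiableAt two_ne_zero
      have hc : HasDerivAt (fun y : ℝ => (⟨w.re, y⟩ : ℂ)) Complex.I y := by
        have : (fun y : ℝ => (⟨w.re, y⟩ : ℂ)) = fun y : ℝ => (w.re : ℂ) + y * Complex.I := by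
          ext y
          exact Complex.mk_eq_add_mul_I _ _
        rw [this]
        simpa using ((Complex.ofRealCLM.hasDerivAt (x := y)).mul_const Complex.I).const_add (w.re : ℂ)
      exact (hd.hasFDerivAt.comp_hasDerivAt y hc).hasDerivWithinAt
    have hmv := (convex_Iio (-R)).norm_image_sub_le_of_norm_hasDerivWithin_le hderiv
      (fun y hy => hR ⟨w.re, y⟩ hwr hy) (show -(R + 1) ∈ Iio (-R) by rw [mem_Iio]; linarith)
      (show w.im ∈ Iio (-R) by rw [mem_Iio]; linarith)
    rw [Complex.eta, Real.norm_eq_abs, Real.norm_eq_abs] at hmv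
    have hb : |φ ⟨w.re, -(R + 1)⟩| ≤ C := by
      refine hC _ (mem_image_of_mem φ ⟨mem_closedFluidDomain.2 ?_, hwr, le_rfl⟩)
      have := hRf w.re
      simp only
      linarith
    have h2 : |φ w| ≤ |φ w - φ ⟨w.re, -(R + 1)⟩| + |φ ⟨w.re, -(R + 1)⟩| := by
      simpa using abs_add_le (φ w - φ ⟨w.re, -(R + 1)⟩) (φ ⟨w.re, -(R + 1)⟩)
    have h3 : |w.im - -(R + 1)| ≤ |w.im| + |R + 1| := by
      rw [sub_neg_eq_add]; exact abs_add_le w.im (R + 1)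
    nlinarith

theorem IsSublinearExtension.translate {f : ℝ → ℝ} {φ : ℂ → ℝ} (h : IsSublinearExtension f φ)
    (s c : ℝ) : IsSublinearExtension (fun x => f (x + s) + c) fun z => φ (z + ⟨s, -c⟩) + c := by
  have hmem : ∀ z ∈ closedFluidDomain (fun x => f (x + s) + c),
      z + ⟨s, -c⟩ ∈ closedFluidDomain f := fun z hz => by
    rw [mem_closedFluidDomain] at hz ⊢
    simp only [Complex.add_re, Complex.add_im]
    linarith
  have hmem' : ∀ z ∈ fluidDomain (fun x => f (x + s) + c),
      z + ⟨s, -c⟩ ∈ fluidDomain f := fun z hz => by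
    rw [mem_fluidDomain] at hz ⊢
    simp only [Complex.add_re, Complex.add_im]
    linarith
  refine ⟨fun z hz => ?_, fun z hz => ?_, ?_, fun x => ?_, fun δ hδ => ?_⟩
  · rw [add_right_comm, h.periodic _ (hmem z hz)]
  · exact (HarmonicAt.comp_add_const (h.harmonic _ (hmem' z hz))).add
      (InnerProductSpace.harmonicAt_const c)
  · exact (h.continuousOn.comp (continuous_add_const _).continuousOn hmem).add continuousOn_const
  · have : (⟨x, f (x + s) + c⟩ : ℂ) + ⟨s, -c⟩ = ⟨x + s, f (x + s)⟩ := by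
      apply Complex.ext <;> simp
    rw [this, h.boundary]
  · obtain ⟨C, hC⟩ := h.sublinear δ hδ
    refine ⟨C + δ * |c| + |c|, fun z hz => ?_⟩
    have h1 := hC _ (hmem z hz)
    have h2 : |(z + ⟨s, -c⟩ : ℂ).im| ≤ |z.im| + |c| := by
      simpa using abs_add_le z.im (-c)
    have h3 := abs_add_le (φ (z + ⟨s, -c⟩)) c
    nlinarith

/-- The harmonic extension of the height of the free surface lies above the height. -/
theorem IsSublinearExtension.im_le {f : ℝ → ℝ} {φ : ℂ → ℝ} (h : IsSublinearExtension f φ)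
    (hf : Continuous f) (hfp : Function.Periodic f (2 * Real.pi)) {z : ℂ}
    (hz : z ∈ closedFluidDomain f) : z.im ≤ φ z := by
  refine sub_nonpos.1 (nonpos_of_harmonicOnNhd (u := Complex.im - φ) hf hfp (fun w hw => ?_)
    (fun w hw => (harmonicAt_im w).sub (h.harmonic w hw))
    (Complex.continuous_im.continuousOn.sub h.continuousOn) (fun x => ?_) ?_ hz)
  · simp [h.periodic w hw, -Complex.ofReal_mul]
  · simp [h.boundary x]
  · obtain ⟨C, hC⟩ := h.sublinear (1 / 2) (by norm_num)
    refine ⟨2 * |C|, fun w hw hwi => ?_⟩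
    have h1 := abs_le.1 (hC w hw)
    have h2 := le_abs_self C
    have h3 := abs_nonneg C
    rw [abs_of_neg (a := w.im) (by linarith)] at h1
    simp only [Pi.sub_apply]
    linarith [h1.1]

/-- Monotonicity of the harmonic extension of the height with respect to the domain. -/
theorem IsSublinearExtension.mono {f g : ℝ → ℝ} {φ ψ : ℂ → ℝ} (h : IsSublinearExtension f φ)
    (h' : IsSublinearExtension g ψ) (hf : Continuous f) (hfp : Function.Periodic f (2 * Real.pi))
    (hg : Continuous g) (hgp : Function.Periodic g (2 * Real.pi)) (hfg : ∀ x, f x ≤ g x) {z : ℂ}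
    (hz : z ∈ closedFluidDomain f) : φ z ≤ ψ z := by
  have hsub : closedFluidDomain f ⊆ closedFluidDomain g := fun w hw =>
    mem_closedFluidDomain.2 ((mem_closedFluidDomain.1 hw).trans (hfg _))
  have hsub' : fluidDomain f ⊆ fluidDomain g := fun w hw =>
    mem_fluidDomain.2 ((mem_fluidDomain.1 hw).trans_le (hfg _))
  obtain ⟨m, hm⟩ := Function.Periodic.exists_le_forall (f := fun x => -f x) (c := 2 * Real.pi)
    (fun x => by simp only [hfp x]) (by positivity) hf.neg
  have key : ∀ δ > 0, φ z - ψ z + δ * (z.im + m) ≤ 0 := by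
    intro δ hδ
    refine nonpos_of_harmonicOnNhd (f := f) (u := (φ - ψ) + δ • (Complex.im + fun _ => m)) hf hfp
      (fun w hw => ?_)
      (fun w hw => ((h.harmonic w hw).sub (h'.harmonic w (hsub' hw))).add
        (((harmonicAt_im w).add (InnerProductSpace.harmonicAt_const m)).const_smul))
      ((h.continuousOn.sub (h'.continuousOn.mono hsub)).add
        ((Complex.continuous_im.add continuous_const).const_smul δ).continuousOn)
      (fun x => ?_) ?_ hz
    · simp [h.periodic w hw, h'.periodic w (hsub hw), -Complex.ofReal_mul]
    · have h1 := h'.im_le hg hgp (z := ⟨x, f x⟩) (hsub (mem_closedFluidDomain.2 le_rfl))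
      have h2 : δ * (f x + m) ≤ 0 := mul_nonpos_of_nonneg_of_nonpos hδ.le (by linarith [hm x])
      simp only [Pi.add_apply, Pi.sub_apply, Pi.smul_apply, h.boundary x, smul_eq_mul] at h1 ⊢
      linarith
    · obtain ⟨C, hC⟩ := h.sublinear (δ / 4) (by positivity)
      obtain ⟨C', hC'⟩ := h'.sublinear (δ / 4) (by positivity)
      refine ⟨2 / δ * (|C| + |C'| + δ * |m|), fun w hw hwi => ?_⟩
      have h1 := (abs_le.1 (hC w hw)).2
      have h2 := (abs_le.1 (hC' w (hsub hw))).1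
      have h3 : |C| + |C'| + δ * |m| < δ / 2 * (-w.im) := by
        have : 2 / δ * (|C| + |C'| + δ * |m|) < -w.im := by linarith
        calc |C| + |C'| + δ * |m| = δ / 2 * (2 / δ * (|C| + |C'| + δ * |m|)) := by
              field_simp
          _ < _ := by gcongr
      have h4 : w.im < 0 := by
        have : 0 ≤ 2 / δ * (|C| + |C'| + δ * |m|) := by positivity
        linarith
      rw [abs_of_neg h4] at h1 h2
      simp only [Pi.add_apply, Pi.sub_apply, Pi.smul_apply, smul_eq_mul]
      have := le_abs_self C
      have := le_abs_self C'
      have := mul_le_mul_of_nonneg_left (le_abs_self m) hδ.le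
      linarith
  have hlim : Tendsto (fun δ : ℝ => φ z - ψ z + δ * (z.im + m)) (𝓝[>] 0) (𝓝 (φ z - ψ z)) := by
    have : Continuous fun δ : ℝ => φ z - ψ z + δ * (z.im + m) := by fun_prop
    simpa using (this.tendsto 0).mono_left nhdsWithin_le_nhds
  exact sub_nonpos.1 (_root_.le_of_tendsto hlim (eventually_mem_nhdsWithin.mono key))

/-- Comparison of the Dirichlet-Neumann operators at a point where two surfaces touch. -/
theorem IsSublinearExtension.le_of_tendsto_normal {f g : ℝ → ℝ} {φ ψ : ℂ → ℝ}
    (h : IsSublinearExtension f φ)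
    (h' : IsSublinearExtension g ψ) (hf : Continuous f) (hfp : Function.Periodic f (2 * Real.pi))
    (hg : Continuous g) (hgp : Function.Periodic g (2 * Real.pi)) (hfg : ∀ x, f x ≤ g x) {x v w : ℝ}
    (hx : f x = g x) (hfd : DifferentiableAt ℝ f x)
    (hv : Tendsto (fun k : ℝ => (φ (⟨x, f x⟩ + k * ⟨-deriv f x, 1⟩) - φ ⟨x, f x⟩) / k)
      (𝓝[<] 0) (𝓝 v))
    (hw : Tendsto (fun k : ℝ => (ψ (⟨x, f x⟩ + k * ⟨-deriv f x, 1⟩) - ψ ⟨x, f x⟩) / k)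
      (𝓝[<] 0) (𝓝 w)) : w ≤ v := by
  have hin : ∀ᶠ k : ℝ in 𝓝[<] 0,
      (⟨x, f x⟩ + (k : ℂ) * ⟨-deriv f x, 1⟩ : ℂ) ∈ closedFluidDomain f := by
    have hd : HasDerivAt (fun k : ℝ => f (x + k * -deriv f x) - (f x + k))
        (deriv f x * -deriv f x - 1) 0 := by
      have h1 : HasDerivAt (fun k : ℝ => x + k * -deriv f x) (-deriv f x) 0 := by
        simpa using ((hasDerivAt_id (0:ℝ)).mul_const (-deriv f x)).const_add x
      have h2 : HasDerivAt f (deriv f x) (x + 0 * -deriv f x) := by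
        simpa using hfd.hasDerivAt
      exact (h2.comp (0:ℝ) h1).sub ((hasDerivAt_id (0:ℝ)).const_add (f x))
    have hslope := (hasDerivAt_iff_tendsto_slope_left_right.1 hd).1
    have hneg : deriv f x * -deriv f x - 1 < 0 := by nlinarith [sq_nonneg (deriv f x)]
    filter_upwards [hslope.eventually_lt_const hneg, self_mem_nhdsWithin] with k hk hk0
    have hk0 : k < 0 := hk0
    rw [slope_def_field, div_neg_iff] at hk
    rw [mem_closedFluidDomain]
    simp at hk ⊢
    rcases hk with hk | hk <;> linarith
  refine _root_.le_of_tendsto_of_tendsto hw hv ?_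
  filter_upwards [hin, self_mem_nhdsWithin] with k hk hk0
  have hk0 : k < 0 := hk0
  refine div_le_div_of_nonpos_of_le hk0.le ?_
  have h1 := h.mono h' hf hfp hg hgp hfg hk
  have h2 := h'.boundary x
  rw [h.boundary x, hx, h2, ← hx]
  linarith

theorem IsContinuousInC2.continuousOn {T : ℝ} {f : ℝ → ℝ → ℝ} (h : IsContinuousInC2 T f) :
    ContinuousOn (fun p : ℝ × ℝ => f p.1 p.2) (Icc 0 T ×ˢ univ) := by
  rintro ⟨t, x⟩ ⟨ht, -⟩
  have hu : TendstoUniformly (fun (p : ℝ × ℝ) x => f p.1 x) (f t)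
      (𝓝[Icc 0 T ×ˢ univ] (t, x)) := by
    have h0 := h.continuous t ht 0 (Nat.zero_le _)
    simp only [iteratedDeriv_zero] at h0
    intro V hV
    have hfst : Tendsto (Prod.fst : ℝ × ℝ → ℝ) (𝓝[Icc 0 T ×ˢ univ] (t, x)) (𝓝[Icc 0 T] t) :=
      tendsto_nhdsWithin_iff.2 ⟨(continuous_fst.tendsto (t, x)).mono_left nhdsWithin_le_nhds,
        eventually_mem_nhdsWithin.mono fun p hp => hp.1⟩
    exact hfst.eventually (h0 V hV)
  exact hu.tendsto_comp (h.contDiff t ht).continuous.continuousAt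
    ((continuous_snd.tendsto (t, x)).mono_left nhdsWithin_le_nhds)

/-- The speeds of two solutions at a point where the (translated) graphs touch. -/
theorem IsMuskatSolution.velocity_le {κ ε T : ℝ} (hκ : 0 < κ) (hε : 0 ≤ ε) {f₁ f₂ : ℝ → ℝ → ℝ}
    (h₁ : IsMuskatSolution κ ε T f₁) (h₂ : IsMuskatSolution κ ε T f₂) {t x s : ℝ}
    (ht : t ∈ Ioo 0 T) (hmax : ∀ y, f₁ t y - f₂ t (y + s) ≤ f₁ t x - f₂ t (x + s)) :
    ∃ D ≤ 0, HasDerivAt (fun r => f₁ r x - f₂ r (x + s)) D t := by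
  have htc := Ioo_subset_Icc_self ht
  obtain ⟨v₁, ⟨φ₁, hφ₁, hv₁⟩, hd₁⟩ := h₁.equation t ht x
  obtain ⟨v₂, ⟨φ₂, hφ₂, hv₂⟩, hd₂⟩ := h₂.equation t ht (x + s)
  refine ⟨_, ?_, hd₁.sub hd₂⟩
  have hc₁ := h₁.regular.contDiff t htc
  have hc₂ := h₂.regular.contDiff t htc
  have hp₁ := h₁.regular.periodic t htc
  have hp₂ := h₂.regular.periodic t htc
  have hf₁ : Differentiable ℝ (f₁ t) := hc₁.differentiable two_ne_zero
  have hf₂ : Differentiable ℝ (f₂ t) := hc₂.differentiable two_ne_zero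
  have hs₂ : Differentiable ℝ fun y => f₂ t (y + s) := hf₂.comp (by fun_prop)
  have hmax' : IsLocalMax (fun y => f₁ t y - f₂ t (y + s)) x := Eventually.of_forall hmax
  have hderiv : deriv (fun y => f₁ t y - f₂ t (y + s)) =
      fun y => deriv (f₁ t) y - deriv (f₂ t) (y + s) := by
    ext y
    rw [deriv_fun_sub (hf₁ y) (hs₂ y), deriv_comp_add_const]
  have hfirst : deriv (f₁ t) x = deriv (f₂ t) (x + s) := by
    have := hmax'.deriv_eq_zero
    rw [hderiv] at this
    exact sub_eq_zero.1 this
  have hsecond : iteratedDeriv 2 (f₁ t) x ≤ iteratedDeriv 2 (f₂ t) (x + s) := by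
    have hc₁' : Differentiable ℝ (deriv (f₁ t)) :=
      ((contDiff_succ_iff_deriv (n := 1)).1 hc₁).2.2.differentiable one_ne_zero
    have hc₂' : Differentiable ℝ (deriv (f₂ t)) :=
      ((contDiff_succ_iff_deriv (n := 1)).1 hc₂).2.2.differentiable one_ne_zero
    have hs₂' : Differentiable ℝ fun y => deriv (f₂ t) (y + s) := hc₂'.comp (by fun_prop)
    have := hmax'.deriv_deriv_nonpos
      (hf₁.continuous.sub (hf₂.continuous.comp (continuous_add_const s))).continuousAt
    rw [hderiv, deriv_fun_sub (hc₁' x) (hs₂' x), deriv_comp_add_const] at this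
    simp only [iteratedDeriv_succ, iteratedDeriv_zero]
    linarith
  have hv : v₂ ≤ v₁ := by
    have e₁ := hφ₁.isSublinearExtension hc₁.continuous hp₁
    have e₂ := (hφ₂.isSublinearExtension hc₂.continuous hp₂).translate s (f₁ t x - f₂ t (x + s))
    refine e₁.le_of_tendsto_normal e₂ hc₁.continuous hp₁
      ((hc₂.continuous.comp (continuous_add_const s)).add continuous_const) (fun y => ?_)
      (fun y => by linarith [hmax y]) (by ring) (hf₁ x) hv₁ ?_
    · simp only [add_right_comm y, hp₂ (y + s)]
    · refine hv₂.congr fun k => ?_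
      have hpt : (⟨x, f₁ t x⟩ + ⟨s, -(f₁ t x - f₂ t (x + s))⟩ : ℂ) = ⟨x + s, f₂ t (x + s)⟩ := by
        apply Complex.ext <;> simp
      rw [add_right_comm, hpt, graphNormal, hfirst]
      ring
  nlinarith

/-- The comparison principle for a solution and a translate of another solution. -/
theorem IsMuskatSolution.comparison {κ ε T : ℝ} (hκ : 0 < κ) (hε : 0 ≤ ε) {f₁ f₂ : ℝ → ℝ → ℝ}
    (h₁ : IsMuskatSolution κ ε T f₁) (h₂ : IsMuskatSolution κ ε T f₂) {s c : ℝ}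
    (h0 : ∀ x, f₁ 0 x ≤ f₂ 0 (x + s) + c) : ∀ t ∈ Icc 0 T, ∀ x, f₁ t x ≤ f₂ t (x + s) + c := by
  have hcont : ContinuousOn (fun p : ℝ × ℝ => f₁ p.1 p.2 - f₂ p.1 (p.2 + s)) (Icc 0 T ×ˢ univ) := by
    refine h₁.regular.continuousOn.sub (h₂.regular.continuousOn.comp
      (f := fun p : ℝ × ℝ => (p.1, p.2 + s)) (by fun_prop) fun p hp => ⟨hp.1, mem_univ _⟩)
  have key : ∀ τ ∈ Ioo 0 T, ∀ δ > 0, ∀ x, f₁ τ x - f₂ τ (x + s) - δ * τ ≤ c := by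
    intro τ hτ δ hδ x
    by_contra! hlt
    have hsub : Icc 0 τ ×ˢ Icc 0 (2 * Real.pi) ⊆ Icc 0 T ×ˢ (univ : Set ℝ) :=
      prod_mono (Icc_subset_Icc_right hτ.2.le) (subset_univ _)
    obtain ⟨⟨t₀, x₀⟩, ⟨ht₀, hx₀⟩, hmax⟩ := (isCompact_Icc.prod isCompact_Icc).exists_isMaxOn
      ⟨((0:ℝ), (0:ℝ)), ⟨left_mem_Icc.2 hτ.1.le, left_mem_Icc.2 Real.two_pi_pos.le⟩⟩
      ((hcont.mono hsub).sub
        (by fun_prop : ContinuousOn (fun p : ℝ × ℝ => δ * p.1) (Icc 0 τ ×ˢ Icc 0 (2 * Real.pi))))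
    have hall : ∀ t ∈ Icc 0 τ, ∀ y, f₁ t y - f₂ t (y + s) - δ * t ≤
        f₁ t₀ x₀ - f₂ t₀ (x₀ + s) - δ * t₀ := by
      intro t ht y
      have htT : t ∈ Icc 0 T := Icc_subset_Icc_right hτ.2.le ht
      have hper : Function.Periodic (fun y => f₁ t y - f₂ t (y + s)) (2 * Real.pi) := fun y => by
        simp only [add_right_comm y, h₁.regular.periodic t htT y,
          h₂.regular.periodic t htT (y + s)]
      obtain ⟨y', hy', hyy⟩ := hper.exists_mem_Ico₀ Real.two_pi_pos y
      have : f₁ t y' - f₂ t (y' + s) - δ * t ≤ f₁ t₀ x₀ - f₂ t₀ (x₀ + s) - δ * t₀ :=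
        hmax (show (t, y') ∈ Icc 0 τ ×ˢ Icc 0 (2 * Real.pi) from
        ⟨ht, Ico_subset_Icc_self hy'⟩)
      linarith
    have hpos := hlt.trans_le (hall τ (right_mem_Icc.2 hτ.1.le) x)
    have ht₀pos : 0 < t₀ := by
      refine lt_of_le_of_ne ht₀.1 fun h => ?_
      rw [← h] at hpos
      linarith [h0 x₀]
    obtain ⟨D, hD, hderiv⟩ := h₁.velocity_le hκ hε h₂ ⟨ht₀pos, ht₀.2.trans_lt hτ.2⟩
      (fun y => by linarith [hall t₀ ht₀ y])
    have hderiv' := hderiv.sub ((hasDerivAt_id t₀).const_mul δ)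
    have hslope := (hasDerivAt_iff_tendsto_slope_left_right.1 hderiv').1
    have hnonneg : 0 ≤ D - δ * 1 := by
      refine ge_of_tendsto hslope ?_
      filter_upwards [Ioo_mem_nhdsLT ht₀pos] with t ht
      have := hall t ⟨ht.1.le, ht.2.le.trans ht₀.2⟩ x₀
      rw [slope_def_field]
      refine div_nonneg_of_nonpos ?_ (by linarith [ht.2])
      simp only [Pi.sub_apply, id]
      linarith
    linarith
  have hopen : ∀ t ∈ Ioo 0 T, ∀ x, f₁ t x - f₂ t (x + s) ≤ c := by
    intro t ht x
    refine le_of_forall_pos_le_add fun η hη => ?_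
    have := key t ht (η / t) (div_pos hη ht.1) x
    rw [div_mul_cancel₀ _ ht.1.ne'] at this
    linarith
  intro t ht x
  rw [← sub_le_iff_le_add']
  rcases ht.1.eq_or_lt with rfl | ht0
  · linarith [h0 x]
  have hmem : t ∈ closure (Ioo 0 T) := by
    rw [closure_Ioo (ht0.trans_le ht.2).ne]
    exact ht
  have hline : ContinuousOn (fun r => f₁ r x - f₂ r (x + s)) (Icc 0 T) :=
    hcont.comp (f := fun r : ℝ => (r, x)) (by fun_prop) fun r hr => ⟨hr, mem_univ _⟩
  have := mem_closure_iff_nhdsWithin_neBot.1 hmem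
  have := le_of_tendsto ((hline t ht).mono_left (nhdsWithin_mono t Ioo_subset_Icc_self))
    (eventually_mem_nhdsWithin.mono fun r hr => hopen r hr x)
  linarith

theorem HasModulus.lipSeminorm_le {L : ℝ≥0} {g : ℝ → ℝ} (h : HasModulus (fun r => L * r) g) :
    lipSeminorm g ≤ L := by
  refine iSup_le fun x => iSup_le fun y => iSup_le fun hxy => ?_
  have hpos : 0 < |x - y| := abs_pos.2 (sub_ne_zero.2 hxy)
  rw [← ENNReal.ofReal_coe_nnreal]
  refine ENNReal.ofReal_le_ofReal ((div_le_iff₀ hpos).2 ?_)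
  simpa [Real.dist_eq] using h x y

theorem hasModulus_of_lipSeminorm_ne_top {g : ℝ → ℝ} (h : lipSeminorm g ≠ ∞) :
    HasModulus (fun r => (lipSeminorm g).toNNReal * r) g := by
  intro x y
  rcases eq_or_ne x y with rfl | hxy
  · simp
  have hpos : 0 < |x - y| := abs_pos.2 (sub_ne_zero.2 hxy)
  have h1 : ENNReal.ofReal (|g x - g y| / |x - y|) ≤ lipSeminorm g :=
    le_iSup_of_le x (le_iSup_of_le y (le_iSup_of_le hxy le_rfl))
  have h2 := (ENNReal.ofReal_le_iff_le_toReal h).1 h1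
  rw [div_le_iff₀ hpos] at h2
  simpa [Real.dist_eq, ENNReal.coe_toNNReal_eq_toReal] using h2

/-- The `L^∞` norm over one period bounds a continuous periodic function everywhere. -/
theorem abs_le_torusLInfty {g : ℝ → ℝ} (hg : Continuous g)
    (hgp : Function.Periodic g (2 * Real.pi)) (h : torusLInfty g ≠ ∞) (x : ℝ) :
    |g x| ≤ (torusLInfty g).toReal := by
  have hae : ∀ᵐ y ∂(volume.restrict (Ioc 0 (2 * Real.pi))), ‖g y‖ₑ ≤ torusLInfty g := by
    rw [torusLInfty, eLpNorm_exponent_top]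
    exact ae_le_eLpNormEssSup
  have hae' : ∀ᵐ y ∂(volume.restrict (Ioo 0 (2 * Real.pi))), ‖g y‖ₑ ≤ torusLInfty g :=
    ae_restrict_of_ae_restrict_of_subset Ioo_subset_Ioc_self hae
  have hclosed : IsClosed {y | ‖g y‖ₑ ≤ torusLInfty g} := isClosed_le hg.enorm continuous_const
  have hsub : Ioo 0 (2 * Real.pi) ⊆ {y | ‖g y‖ₑ ≤ torusLInfty g} := by
    rw [ae_restrict_iff' measurableSet_Ioo] at hae'
    have h0 : volume (Ioo 0 (2 * Real.pi) ∩ {y | ‖g y‖ₑ ≤ torusLInfty g}ᶜ) = 0 := by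
      refine measure_mono_null (fun y hy => ?_) (ae_iff.1 hae')
      exact fun hc => hy.2 (hc hy.1)
    have := (isOpen_Ioo.inter hclosed.isOpen_compl).measure_eq_zero_iff volume |>.1 h0
    intro y hy
    by_contra hc
    exact (this ▸ (⟨hy, hc⟩ : y ∈ Ioo 0 (2 * Real.pi) ∩ {y | ‖g y‖ₑ ≤ torusLInfty g}ᶜ) :
      y ∈ (∅ : Set ℝ))
  have hsub' := closure_minimal hsub hclosed
  rw [closure_Ioo Real.two_pi_pos.ne] at hsub'
  obtain ⟨y, hy, hxy⟩ := hgp.exists_mem_Ico₀ Real.two_pi_pos x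
  have hle : ‖g y‖ₑ ≤ torusLInfty g := hsub' (Ico_subset_Icc_self hy)
  rw [hxy, ← Real.norm_eq_abs, ← toReal_enorm]
  exact ENNReal.toReal_mono h hle

theorem torusLInfty_le_ofReal {g : ℝ → ℝ} {C : ℝ} (h : ∀ x, |g x| ≤ C) :
    torusLInfty g ≤ ENNReal.ofReal C := by
  rw [torusLInfty, eLpNorm_exponent_top]
  exact eLpNormEssSup_le_of_ae_bound (Eventually.of_forall h)

theorem IsMuskatSolution.hasModulus {κ ε T : ℝ} (hκ : 0 < κ) (hε : 0 ≤ ε) {f : ℝ → ℝ → ℝ}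
    (h : IsMuskatSolution κ ε T f) {γ : ℝ≥0 → ℝ≥0} (h0 : HasModulus γ (f 0)) :
    ∀ t ∈ Icc 0 T, HasModulus γ (f t) := by
  have key : ∀ t ∈ Icc 0 T, ∀ x y, f t x - f t y ≤ γ (nndist x y) := by
    intro t ht x y
    have := h.comparison hκ hε h (s := y - x) (c := γ (nndist x y)) (fun z => ?_) t ht x
    · rw [add_sub_cancel] at this
      linarith
    · have h1 := (abs_le.1 (h0 z (z + (y - x)))).2
      rw [show nndist z (z + (y - x)) = nndist x y from NNReal.eq (by
        simp [Real.dist_eq, abs_sub_comm])] at h1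
      linarith
  intro t ht x y
  refine abs_le.2 ⟨?_, key t ht x y⟩
  have := key t ht y x
  rw [nndist_comm] at this
  linarith

theorem IsMuskatSolution.hasTorusModulus {κ ε T : ℝ} (hκ : 0 < κ) (hε : 0 ≤ ε) {f : ℝ → ℝ → ℝ}
    (h : IsMuskatSolution κ ε T f) {γ : ℝ≥0 → ℝ≥0} (h0 : HasTorusModulus γ (f 0)) :
    ∀ t ∈ Icc 0 T, HasTorusModulus γ (f t) := by
  have key : ∀ t ∈ Icc 0 T, ∀ x y, f t x - f t y ≤
      γ ‖((x - y : ℝ) : AddCircle (2 * Real.pi))‖₊ := by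
    intro t ht x y
    have := h.comparison hκ hε h (s := y - x)
      (c := γ ‖((x - y : ℝ) : AddCircle (2 * Real.pi))‖₊) (fun z => ?_) t ht x
    · rw [add_sub_cancel] at this
      linarith
    · have h1 := (abs_le.1 (h0 z (z + (y - x)))).2
      rw [show z - (z + (y - x)) = x - y by ring] at h1
      linarith
  intro t ht x y
  refine abs_le.2 ⟨?_, key t ht x y⟩
  have := key t ht y x
  rw [← neg_sub x y, AddCircle.coe_neg, nnnorm_neg] at this
  linarith

theorem IsMuskatSolution.torusLInfty_sub_le {κ ε T : ℝ} (hκ : 0 < κ) (hε : 0 ≤ ε)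
    {f₁ f₂ : ℝ → ℝ → ℝ} (h₁ : IsMuskatSolution κ ε T f₁) (h₂ : IsMuskatSolution κ ε T f₂) :
    ∀ t ∈ Icc 0 T, torusLInfty (fun x => f₁ t x - f₂ t x) ≤
      torusLInfty (fun x => f₁ 0 x - f₂ 0 x) := by
  intro t ht
  rcases eq_or_ne (torusLInfty fun x => f₁ 0 x - f₂ 0 x) ∞ with htop | htop
  · simp [htop]
  have hT0 : (0:ℝ) ∈ Icc 0 T := ⟨le_rfl, ht.1.trans ht.2⟩
  have hb : ∀ x, |f₁ 0 x - f₂ 0 x| ≤ (torusLInfty fun x => f₁ 0 x - f₂ 0 x).toReal :=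
    abs_le_torusLInfty ((h₁.regular.contDiff 0 hT0).continuous.sub
    (h₂.regular.contDiff 0 hT0).continuous)
    ((h₁.regular.periodic 0 hT0).sub (h₂.regular.periodic 0 hT0)) htop
  rw [← ENNReal.ofReal_toReal htop]
  set C := (torusLInfty fun x => f₁ 0 x - f₂ 0 x).toReal
  refine torusLInfty_le_ofReal fun x => abs_le.2 ⟨?_, ?_⟩
  · have := h₂.comparison hκ hε h₁ (s := 0) (c := C) (fun y => by
      rw [add_zero]; linarith [(abs_le.1 (hb y)).1]) t ht x
    rw [add_zero] at this
    linarith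
  · have := h₁.comparison hκ hε h₂ (s := 0) (c := C) (fun y => by
      rw [add_zero]; linarith [(abs_le.1 (hb y)).2]) t ht x
    rw [add_zero] at this
    linarith

theorem IsMuskatSolution.lipSeminorm_le {κ ε T : ℝ} (hκ : 0 < κ) (hε : 0 ≤ ε) {f : ℝ → ℝ → ℝ}
    (h : IsMuskatSolution κ ε T f) : ∀ t ∈ Icc 0 T, lipSeminorm (f t) ≤ lipSeminorm (f 0) := by
  intro t ht
  rcases eq_or_ne (lipSeminorm (f 0)) ∞ with htop | htop
  · simp [htop]
  · have := (h.hasModulus hκ hε (hasModulus_of_lipSeminorm_ne_top htop) t ht).lipSeminorm_le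
    rwa [ENNReal.coe_toNNReal htop] at this

theorem mainTheorem11 (κ ε T : ℝ) (hκ : 0 < κ) (hε : 0 ≤ ε) (hT : 0 < T) :
    (∀ f₁ f₂ : ℝ → ℝ → ℝ, IsMuskatSolution κ ε T f₁ → IsMuskatSolution κ ε T f₂ →
      (∀ x, f₁ 0 x ≤ f₂ 0 x) → ∀ t ∈ Set.Icc 0 T, ∀ x, f₁ t x ≤ f₂ t x) ∧
    (∀ f : ℝ → ℝ → ℝ, IsMuskatSolution κ ε T f →
      (∀ γ : ℝ≥0 → ℝ≥0, HasModulus γ (f 0) → ∀ t ∈ Set.Icc 0 T, HasModulus γ (f t)) ∧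
      (∀ γ : ℝ≥0 → ℝ≥0, HasTorusModulus γ (f 0) →
        ∀ t ∈ Set.Icc 0 T, HasTorusModulus γ (f t)) ∧
      (∀ t ∈ Set.Icc 0 T, lipSeminorm (f t) ≤ lipSeminorm (f 0))) ∧
    (∀ f₁ f₂ : ℝ → ℝ → ℝ, IsMuskatSolution κ ε T f₁ → IsMuskatSolution κ ε T f₂ →
      ∀ t ∈ Set.Icc 0 T, torusLInfty (fun x => f₁ t x - f₂ t x) ≤
        torusLInfty (fun x => f₁ 0 x - f₂ 0 x)) := by
  refine ⟨fun f₁ f₂ h₁ h₂ h0 t ht x => ?_, fun f h => ⟨fun γ h0 => h.hasModulus hκ hε h0,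
    fun γ h0 => h.hasTorusModulus hκ hε h0, h.lipSeminorm_le hκ hε⟩,
    fun f₁ f₂ h₁ h₂ => h₁.torusLInfty_sub_le hκ hε h₂⟩
  have := h₁.comparison hκ hε h₂ (s := 0) (c := 0) (by simpa using h0) t ht x
  simpa using this
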